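/- **Setting.** A *bandit algorithm* $\mathcal B$ with $N$ actions, used for $T$ rounds, commits in each round $t$ to a distribution $q^t$ on the actions, which is a (measurable) function of its own past actions and observed rewards; an adaptive adversary, knowing the past and $q^t$, chooses a reward vector $b^t\in[0,1]^N$; then $a^t\sim q^t$ is drawn and $b^t_{a^t}$ is observed. The *average swap regret* is $\frac1T\big(\max_{f:[N]\to[N]}\sum_{t} b^t_{f(a^t)}-\sum_{t} b^t_{a^t}\big)$. Let $B(\epsilon)\in\mathbb N\cup\{\infty\}$ be the least $B$ such that for all $T\ge B$ the expected average swap regret of $\mathcal B$, used for $T$ rounds, is at most $\epsilon$ against every adaptive adversary, and let $$B(\epsilon,N)=\max\Big\{B(\epsilon),\ \Big\lceil \tfrac{2\,(N\log N+\log(2/\epsilon))}{\epsilon^2}\Big\rceil\Big\}$$ (where a negative second entry counts as $0$). A *game with stochastic rewards* has $M$ players with $N$ actions each, a probability distribution $r$ on a set $\Theta$ of reward tensors, and utilities $u_i(a,\theta)\in[0,1]$; in each round the players simultaneously choose actions, $\theta\sim r$ is drawn independently, and player $i$ observes only $u_i(a,\theta)$. The rewards may thus be noisy and arbitrarily correlated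 across players. The mean reward tensor is $\bar\theta_{a,i}=\mathbb E_{\theta\sim r}[u_i(a,\theta)]$. A distribution $D$ on action profiles is an *$\epsilon$-correlated equilibrium* if $\mathbb E_{a\sim D}[\bar\theta_{a,i}]\ge \mathbb E_{a\sim D}[\bar\theta_{(f(a_i);a_{-i}),i}]-\epsilon$ for every player $i$ and every swap function $f:[N]\to[N]$. **Theorem.** Let $\mathcal B$ be any bandit algorithm with $N$ actions, let $\epsilon>0$, and let $T\ge 1$ be an integer with $T\ge B(\epsilon/4,N)$. If all players of a game with stochastic rewards select their actions with (independent copies of) $\mathcal B$ for $T$ rounds, then the empirical distribution $D_T$ of the sequence of action profiles is an $\epsilon$-correlated equilibrium in expectation, with respect to the mean reward tensor: for every player $i$, $$\mathbb E\Big[\max_{f:[N]\to[N]}\ \mathbb E_{a\sim D_T}\big[\bar\theta_{(f(a_i);a_{-i}),i}-\bar\theta_{a,i}\big]\Big]\le\epsilon ,$$ where the outer expectation is over the reward tensors and the randomness of $\mathcal B$. In particular, the distribution $\mathbb E[D_T]$ is an $\epsilon$-correlated equilibrium. -/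

import Mathlib

open MeasureTheory

noncomputable section

namespace StochasticRewards

/-! ### Adversarial bandits and swap regret -/

/-- A (randomized) algorithm for the adversarial bandit problem with `N` actions. When it is used
for `T` rounds, then in round `t` (numbered from `0`) it commits to the distribution
`play T t h` on the actions, where `h` lists the actions that it drew and the rewards that it
observed in the rounds before `t`. The algorithm may depend on `T` (e.g. through a step size). -/
structure BanditAlgorithm (N : ℕ) where
  play : (T : ℕ) → (t : ℕ) → (Fin t → Fin N × ℝ) → stdSimplex ℝ (Fin N)
  measurable_play : ∀ (T t : ℕ) (j : Fin N),
    Measurable fun h : Fin t → Fin N × ℝ => (play T t h : Fin N → ℝ) j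

/-- An adaptive adversary for the bandit problem with `N` actions. In round `t` it chooses the
reward vector `reward t past ∈ [0,1]^N`, where `past` lists the actions drawn before round `t`.
(Given the algorithm, the earlier reward vectors and the distributions committed to up to and
including round `t` are functions of `past`, so the adversary knows them too.) -/
structure AdaptiveAdversary (N : ℕ) where
  reward : (t : ℕ) → (Fin t → Fin N) → Fin N → ℝ
  reward_mem : ∀ (t : ℕ) (past : Fin t → Fin N) (j : Fin N), reward t past j ∈ Set.Icc (0 : ℝ) 1

/-- The restriction of a sequence of length `T` to the rounds before `t`. -/
def before {α : Type*} {T : ℕ} (x : Fin T → α) (t : Fin T) : Fin (t : ℕ) → α :=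
  fun s => x (Fin.castLE t.isLt.le s)

/-- The product over the rounds of the probability with which the algorithm, having drawn
the actions `a s` and observed the rewards `x s` in the rounds `s < t`, draws `a t` in round
`t`. -/
def BanditAlgorithm.seqProb {N : ℕ} (𝓑 : BanditAlgorithm N) {T : ℕ}
    (a : Fin T → Fin N) (x : Fin T → ℝ) : ℝ :=
  ∏ t : Fin T, (𝓑.play T t (before (fun s => (a s, x s)) t) : Fin N → ℝ) (a t)

/-- The reward vectors chosen by an adaptive adversary when the actions `a` are drawn. -/
def AdaptiveAdversary.rewards {N : ℕ} (β : AdaptiveAdversary N) {T : ℕ} (a : Fin T → Fin N) :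
    Fin T → Fin N → ℝ :=
  fun t => β.reward t (before a t)

/-- The swap regret
`max_f ∑_t b^t_{f(a^t)} - ∑_t b^t_{a^t}` of the actions `a` for the reward vectors `b`, where `f`
ranges over all swap functions. -/
def swapRegret {N T : ℕ} (a : Fin T → Fin N) (b : Fin T → Fin N → ℝ) : ℝ :=
  (Finset.univ : Finset (Fin N → Fin N)).sup' ⟨id, Finset.mem_univ _⟩
      (fun f => ∑ t, b t (f (a t)))
    - ∑ t, b t (a t)

/-- The expected average swap regret of the algorithm when it is used for `T` rounds against
an adaptive adversary. -/
def BanditAlgorithm.expAvgSwapRegret {N : ℕ} (𝓑 : BanditAlgorithm N) (T : ℕ)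
    (β : AdaptiveAdversary N) : ℝ :=
  ∑ a : Fin T → Fin N,
    𝓑.seqProb a (fun t => β.rewards a t (a t)) * (swapRegret a (β.rewards a) / T)

/-- `B(ε)`: the number of rounds after which the algorithm has expected average swap regret at most
`ε` against every adaptive adversary (`⊤` if there is no such number). -/
def BanditAlgorithm.rounds {N : ℕ} (𝓑 : BanditAlgorithm N) (ε : ℝ) : ℕ∞ :=
  ⨅ (B : ℕ) (_ : ∀ T : ℕ, B ≤ T → ∀ β : AdaptiveAdversary N, 𝓑.expAvgSwapRegret T β ≤ ε), (B : ℕ∞)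

/-- `B(ε, N)`: the number of rounds `B(ε)`, extended where necessary to
`2 (N log N + log (2 / ε)) / ε ^ 2` rounds. -/
def BanditAlgorithm.extendedRounds {N : ℕ} (𝓑 : BanditAlgorithm N) (ε : ℝ) : ℕ∞ :=
  max (𝓑.rounds ε) ((⌈2 * (N * Real.log N + Real.log (2 / ε)) / ε ^ 2⌉₊ : ℕ) : ℕ∞)

/-! ### Games with stochastic rewards -/

/-- A game with stochastic rewards with `M` players, each with `N` actions: a probability
distribution `r` on `Θ`, and utilities `u a θ i ∈ [0,1]` of player `i` under the action profile `a`
and the realization `θ`. -/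
structure Game (M N : ℕ) (Θ : Type*) [MeasurableSpace Θ] where
  r : Measure Θ
  isProbabilityMeasure_r : IsProbabilityMeasure r
  u : (Fin M → Fin N) → Θ → Fin M → ℝ
  u_mem : ∀ (a : Fin M → Fin N) (θ : Θ) (i : Fin M), u a θ i ∈ Set.Icc (0 : ℝ) 1
  measurable_u : ∀ (a : Fin M → Fin N) (i : Fin M), Measurable fun θ => u a θ i

/-- The profile `(f(a_i); a_{-i})`. -/
def deviate {M N : ℕ} (i : Fin M) (f : Fin N → Fin N) (a : Fin M → Fin N) : Fin M → Fin N :=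
  Function.update a i (f (a i))

/-- The mean reward tensor. -/
def Game.mean {M N : ℕ} {Θ : Type*} [MeasurableSpace Θ] (G : Game M N Θ)
    (a : Fin M → Fin N) (i : Fin M) : ℝ :=
  ∫ θ, G.u a θ i ∂G.r

/-- `D` is an `ε`-correlated equilibrium: it is a distribution on the action profiles, and no
player gains more than `ε` in expected reward (over the profile and over `θ`) by any swap
function. -/
def Game.IsCorrelatedEquilibrium {M N : ℕ} {Θ : Type*} [MeasurableSpace Θ] (G : Game M N Θ)
    (ε : ℝ) (D : (Fin M → Fin N) → ℝ) : Prop :=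
  D ∈ stdSimplex ℝ (Fin M → Fin N) ∧
    ∀ (i : Fin M) (f : Fin N → Fin N),
      ∑ a, D a * G.mean a i ≥ ∑ a, D a * G.mean (deviate i f a) i - ε

/-- The largest expected gain, with respect to the mean reward tensor, that player `i` can achieve
by a swap function when action profiles are distributed as `D`. -/
def Game.swapGain {M N : ℕ} {Θ : Type*} [MeasurableSpace Θ] (G : Game M N Θ)
    (D : (Fin M → Fin N) → ℝ) (i : Fin M) : ℝ :=
  (Finset.univ : Finset (Fin N → Fin N)).sup' ⟨id, Finset.mem_univ _⟩
      (fun f => ∑ a, D a * G.mean (deviate i f a) i)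
    - ∑ a, D a * G.mean a i

/-- The empirical distribution of a sequence of action profiles. -/
def empirical {M N T : ℕ} (a : Fin T → Fin M → Fin N) (p : Fin M → Fin N) : ℝ :=
  (∑ t, if a t = p then (1 : ℝ) else 0) / T

/-- The probability that the sequence of action profiles is `a` when all players use `𝓑` for `T`
rounds. The tensors `θ^0, …, θ^{T-1}` are drawn independently from `r`; given them, each player `i`
draws its action in each round, independently of the other players, from the distribution that
its copy of `𝓑` assigns to its own past actions and its own observed utilities
`u_i(a^s, θ^s)`. -/
def Game.playProb {M N : ℕ} {Θ : Type*} [MeasurableSpace Θ] (G : Game M N Θ)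
    (𝓑 : BanditAlgorithm N) {T : ℕ} (a : Fin T → Fin M → Fin N) : ℝ :=
  haveI := G.isProbabilityMeasure_r
  ∫ θ : Fin T → Θ,
    ∏ i : Fin M, 𝓑.seqProb (fun t => a t i) (fun t => G.u (a t) (θ t) i)
    ∂(Measure.pi fun _ => G.r)

/-- The expectation of a quantity that depends on the sequence of action profiles, when all
players use `𝓑` for `T` rounds. -/
def Game.playExp {M N : ℕ} {Θ : Type*} [MeasurableSpace Θ] (G : Game M N Θ)
    (𝓑 : BanditAlgorithm N) (T : ℕ) (F : (Fin T → Fin M → Fin N) → ℝ) : ℝ :=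
  ∑ a : Fin T → Fin M → Fin N, G.playProb 𝓑 a * F a

end StochasticRewards

end

namespace StochasticRewards

/-! ### Paths generated by history-dependent kernels -/

/-! For each swap function `f`, the average mean gain of player `i` is the average realized gain
plus an average deviation, and the two are bounded separately.

Realized gains: fix the whole tensor sequence `θ`. The other players then form a randomized adaptive
adversary, since in each round they draw independently of player `i`. Some deterministic adversary
does at least as well (`exists_replyPath_ge`), so the regret guarantee of the algorithm applies for
every `θ` (`Game.sum_jointWeight_mul_swapRegret_le`).

Deviations: the profile of a round is drawn before the fresh tensor, so each deviation has
conditional mean zero and its exponential moments multiply over the rounds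
(`lintegral_sum_prod_kernel_le`). A soft maximum over the `N ^ N` swap functions costs `N log N` in
the exponent. Both bounds are added on each path and averaged in
`Game.playExp_swapGain_le_of_regret`. -/

lemma before_cons_succ {α γ : Type*} {T : ℕ} (F : (t : ℕ) → (Fin t → α) → γ) (x : α)
    (y : Fin T → α) (t : Fin T) :
    F (t.succ : Fin (T + 1)) (before (Fin.cons x y : Fin (T + 1) → α) t.succ)
      = F ((t : ℕ) + 1) (Fin.cons x (before y t) : Fin ((t : ℕ) + 1) → α) := by
  change F ((t : ℕ) + 1) _ = _
  congr 1
  funext s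
  refine Fin.cases ?_ (fun s => ?_) s <;> rfl

lemma before_zero {α γ : Type*} {T : ℕ} (F : (t : ℕ) → (Fin t → α) → γ) (y : Fin (T + 1) → α) :
    F (0 : Fin (T + 1)) (before y 0) = F 0 Fin.elim0 := by
  change F 0 _ = _
  congr 1
  funext s
  exact s.elim0

lemma sum_fin_succ_pi {α R : Type*} [Fintype α] [AddCommMonoid R] {T : ℕ}
    (F : (Fin (T + 1) → α) → R) :
    ∑ z, F z = ∑ x : α, ∑ y : Fin T → α, F (Fin.cons x y) := by
  rw [← Fintype.sum_prod_type']
  exact ((Fin.consEquiv (fun _ : Fin (T + 1) => α)).sum_comp F).symm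

/-- The weights of the paths generated by probability kernels sum to one. -/
lemma sum_prod_kernel_eq_one {α : Type*} [Fintype α] : ∀ (T : ℕ)
    (κ : (t : ℕ) → (Fin t → α) → α → ℝ) (_ : ∀ t h, ∑ x, κ t h x = 1),
    ∑ z : Fin T → α, ∏ t : Fin T, κ t (before z t) (z t) = 1
  | 0, κ, _ => by simp
  | T + 1, κ, hκ => by
    rw [sum_fin_succ_pi]
    simp only [Fin.prod_univ_succ, before_cons_succ κ, before_zero κ, Fin.cons_zero, Fin.cons_succ]
    simp only [← Finset.mul_sum]
    rw [← hκ 0 Fin.elim0]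
    refine Finset.sum_congr rfl fun x _ => ?_
    rw [sum_prod_kernel_eq_one T (fun t h => κ (t + 1) (Fin.cons x h)) fun t h => hκ _ _, mul_one]

/-- The joint path of a sequence `a` and of the replies `g` to it. -/
def replyPath {A Y : Type*} {T : ℕ} (g : (t : ℕ) → (Fin t → A) → Y) (a : Fin T → A) :
    Fin T → A × Y :=
  fun t => (a t, g t (before a t))

/-- Against a randomized adaptive opponent there is a deterministic adaptive opponent that does at
least as well. -/
lemma exists_replyPath_ge {A Y : Type*} [Fintype A] [Fintype Y] : ∀ (T : ℕ)
    (q : (t : ℕ) → (Fin t → A × Y) → A → ℝ) (ρ : (t : ℕ) → (Fin t → A × Y) → Y → ℝ)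
    (W : (Fin T → A × Y) → ℝ)
    (_ : ∀ t h x, 0 ≤ q t h x) (_ : ∀ t h y, 0 ≤ ρ t h y) (_ : ∀ t h, ∑ y, ρ t h y = 1),
    ∃ g : (t : ℕ) → (Fin t → A) → Y,
      ∑ z : Fin T → A × Y,
          (∏ t : Fin T, q t (before z t) (z t).1 * ρ t (before z t) (z t).2) * W z
        ≤ ∑ a : Fin T → A,
          (∏ t : Fin T, q t (before (replyPath g a) t) (a t)) * W (replyPath g a)
  | 0, q, ρ, W, hq, hρ, hρ1 => by
    have hY : Nonempty Y := by
      by_contra h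
      rw [not_nonempty_iff] at h
      simpa using hρ1 0 Fin.elim0
    refine ⟨fun _ _ => hY.some, le_of_eq ?_⟩
    simp only [Finset.univ_unique, Finset.univ_eq_empty, Finset.prod_empty, one_mul,
      Finset.sum_singleton]
    congr 1
    exact Subsingleton.elim _ _
  | T + 1, q, ρ, W, hq, hρ, hρ1 => by
    -- The induction removes the first round: each first outcome `z` has its own deterministic
    -- continuation `g z`, of value `V z`.
    have ih := fun z : A × Y => exists_replyPath_ge T
      (fun t h => q (t + 1) (Fin.cons z h)) (fun t h => ρ (t + 1) (Fin.cons z h))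
      (fun y => W (Fin.cons z y)) (fun _ _ _ => hq _ _ _) (fun _ _ _ => hρ _ _ _)
      (fun _ _ => hρ1 _ _)
    choose g hg using ih
    set V : A × Y → ℝ := fun z => ∑ a : Fin T → A,
      (∏ t : Fin T, q (t + 1) (Fin.cons z (before (replyPath (g z) a) t)) (a t)) *
        W (Fin.cons z (replyPath (g z) a)) with hV
    have hY : Nonempty Y := by
      by_contra h
      rw [not_nonempty_iff] at h
      simpa using hρ1 0 Fin.elim0
    -- The reply is fixed before the action `x` is seen, so it maximizes the value averaged over
    -- `x`; this maximum is at least the `ρ`-average.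
    obtain ⟨y₀, hy₀⟩ := Finite.exists_max fun y => ∑ x, q 0 Fin.elim0 x * V (x, y)
    let g' : (t : ℕ) → (Fin t → A) → Y := fun t => match t with
      | 0 => fun _ => y₀
      | t + 1 => fun h => g (h 0, y₀) t (Fin.tail h)
    have hpath : ∀ (x : A) (a : Fin T → A), replyPath g' (Fin.cons x a : Fin (T + 1) → A)
        = Fin.cons (x, y₀) (replyPath (g (x, y₀)) a) := by
      intro x a
      funext t
      refine Fin.cases ?_ (fun s => ?_) t
      · rfl
      · simp only [replyPath, Fin.cons_succ, Prod.mk.injEq, true_and]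
        rw [before_cons_succ g']
        simp [g']
    refine ⟨g', ?_⟩
    have hR : ∑ a : Fin (T + 1) → A,
          (∏ t : Fin (T + 1), q t (before (replyPath g' a) t) (a t)) * W (replyPath g' a)
        = ∑ x, q 0 Fin.elim0 x * V (x, y₀) := by
      rw [sum_fin_succ_pi]
      refine Finset.sum_congr rfl fun x _ => ?_
      rw [hV, Finset.mul_sum]
      refine Finset.sum_congr rfl fun a _ => ?_
      rw [hpath, Fin.prod_univ_succ]
      simp only [before_cons_succ q, before_zero q, Fin.cons_zero, Fin.cons_succ, mul_assoc]
    rw [hR, sum_fin_succ_pi]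
    calc _ ≤ ∑ z : A × Y, q 0 Fin.elim0 z.1 * ρ 0 Fin.elim0 z.2 * V z := by
          refine Finset.sum_le_sum fun z _ => ?_
          refine le_trans (le_of_eq ?_) (mul_le_mul_of_nonneg_left (hg z)
            (mul_nonneg (hq 0 Fin.elim0 z.1) (hρ 0 Fin.elim0 z.2)))
          rw [Finset.mul_sum]
          refine Finset.sum_congr rfl fun a _ => ?_
          rw [Fin.prod_univ_succ]
          simp only [before_cons_succ q, before_zero q, before_cons_succ ρ, before_zero ρ,
            Fin.cons_zero, Fin.cons_succ, mul_assoc]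
      _ = ∑ y, ρ 0 Fin.elim0 y * ∑ x, q 0 Fin.elim0 x * V (x, y) := by
          rw [Fintype.sum_prod_type_right]
          refine Finset.sum_congr rfl fun y _ => ?_
          rw [Finset.mul_sum]
          exact Finset.sum_congr rfl fun x _ => by ring
      _ ≤ ∑ y, ρ 0 Fin.elim0 y * ∑ x, q 0 Fin.elim0 x * V (x, y₀) :=
          Finset.sum_le_sum fun y _ => mul_le_mul_of_nonneg_left (hy₀ y) (hρ 0 Fin.elim0 y)
      _ = _ := by rw [← Finset.sum_mul, hρ1, one_mul]

/-- If the next action is drawn before the next fresh sample, and every action has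
exponential moment at most `C`, then after `T` rounds the exponential moment is at most `C ^ T`. -/
lemma lintegral_sum_prod_kernel_le {P Θ : Type*} [Fintype P] [MeasurableSpace Θ] (μ : Measure Θ)
    [IsProbabilityMeasure μ] (φ : P → Θ → ENNReal) (hφ : ∀ p, Measurable (φ p)) (C : ENNReal)
    (hC : ∀ p, ∫⁻ θ, φ p θ ∂μ ≤ C) : ∀ (T : ℕ) (κ : (t : ℕ) → (Fin t → P × Θ) → P → ENNReal)
    (_ : ∀ t (a : Fin t → P) p, Measurable fun θ : Fin t → Θ => κ t (fun s => (a s, θ s)) p)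
    (_ : ∀ t h, ∑ p, κ t h p ≤ 1),
    ∫⁻ θ : Fin T → Θ, ∑ a : Fin T → P,
      ∏ t : Fin T, κ t (before (fun s => (a s, θ s)) t) (a t) * φ (a t) (θ t) ∂(Measure.pi fun _ => μ)
      ≤ C ^ T
  | 0, κ, _, _ => by simp
  | T + 1, κ, hκm, hκ => by
    have hmeas : Measurable fun θ : Fin (T + 1) → Θ => ∑ a : Fin (T + 1) → P,
        ∏ t : Fin (T + 1), κ t (before (fun s => (a s, θ s)) t) (a t) * φ (a t) (θ t) := by
      refine Finset.measurable_sum _ fun a _ => Finset.measurable_prod _ fun t _ => ?_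
      refine Measurable.mul ?_ ((hφ _).comp (measurable_pi_apply t))
      exact (hκm t (before a t) (a t)).comp
        (g := fun θ : Fin t → Θ => κ t (fun s => (before a t s, θ s)) (a t))
        (f := fun θ : Fin (T + 1) → Θ => before θ t)
        (measurable_pi_lambda _ fun s => measurable_pi_apply _)
    -- The later kernels depend on the first sample, so Tonelli is used with the later samples
    -- innermost.
    have hmp := (measurePreserving_piFinSuccAbove (fun _ : Fin (T + 1) => μ) 0).symm
    rw [← hmp.lintegral_comp hmeas]
    refine (lintegral_prod _ (hmeas.comp hmp.measurable).aemeasurable).trans_le ?_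
    have hcons : ∀ (x : Θ) (y : Fin T → Θ),
        (MeasurableEquiv.piFinSuccAbove (fun _ : Fin (T + 1) => Θ) 0).symm (x, y)
          = (Fin.cons x y : Fin (T + 1) → Θ) := fun x y => by
      simp [MeasurableEquiv.piFinSuccAbove, Fin.insertNthEquiv, Fin.insertNth_zero']
    have hpair : ∀ (p : P) (a : Fin T → P) (x : Θ) (y : Fin T → Θ),
        (fun s : Fin (T + 1) => ((Fin.cons p a : Fin (T + 1) → P) s,
          (Fin.cons x y : Fin (T + 1) → Θ) s)) = Fin.cons (p, x) (fun s => (a s, y s)) := by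
      intro p a x y
      funext s
      refine Fin.cases ?_ (fun s => ?_) s <;> rfl
    have hin : ∀ x : Θ, ∫⁻ y : Fin T → Θ, (∑ a : Fin (T + 1) → P,
          ∏ t : Fin (T + 1), κ t (before (fun s => (a s, (Fin.cons x y : Fin (T + 1) → Θ) s)) t) (a t)
            * φ (a t) ((Fin.cons x y : Fin (T + 1) → Θ) t)) ∂(Measure.pi fun _ => μ)
        ≤ ∑ p, κ 0 Fin.elim0 p * φ p x * C ^ T := by
      intro x
      have hm : ∀ p : P, Measurable fun y : Fin T → Θ => ∑ a : Fin T → P,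
          ∏ t : Fin T, κ (t + 1) (Fin.cons (p, x) (before (fun s => (a s, y s)) t)) (a t)
            * φ (a t) (y t) := by
        intro p
        refine Finset.measurable_sum _ fun a _ => Finset.measurable_prod _ fun t _ => ?_
        refine Measurable.mul ?_ ((hφ _).comp (measurable_pi_apply t))
        have := (hκm (t + 1) (Fin.cons p (before a t)) (a t)).comp
          (f := fun y : Fin T → Θ => (Fin.cons x (before y t) : Fin ((t : ℕ) + 1) → Θ)) (by
            refine measurable_pi_lambda _ fun s => ?_
            refine Fin.cases ?_ (fun s => ?_) s
            · simp
            · exact measurable_pi_apply (Fin.castLE t.isLt.le s))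
        convert this using 1
        funext y
        simp only [Function.comp]
        congr 1
        funext s
        refine Fin.cases ?_ (fun s => ?_) s <;> rfl
      simp only [sum_fin_succ_pi, hpair, Fin.prod_univ_succ, before_cons_succ κ, before_zero κ,
        Fin.cons_zero, Fin.cons_succ]
      simp only [← Finset.mul_sum]
      rw [lintegral_finsetSum _ fun p _ => (hm p).const_mul _]
      refine Finset.sum_le_sum fun p _ => ?_
      rw [lintegral_const_mul _ (hm p)]
      gcongr
      refine lintegral_sum_prod_kernel_le μ φ hφ C hC T
        (fun t h => κ (t + 1) (Fin.cons (p, x) h)) (fun t a p' => ?_) (fun t h => hκ _ _)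
      have := (hκm (t + 1) (Fin.cons p a) p').comp
          (f := fun y : Fin t → Θ => (Fin.cons x y : Fin (t + 1) → Θ)) (by
            refine measurable_pi_lambda _ fun s => ?_
            refine Fin.cases ?_ (fun s => ?_) s
            · simp
            · simpa using measurable_pi_apply _)
      convert this using 1
      funext y
      simp only [Function.comp]
      congr 1
      funext s
      refine Fin.cases ?_ (fun s => ?_) s <;> rfl
    calc _ ≤ ∫⁻ x, ∑ p, κ 0 Fin.elim0 p * φ p x * C ^ T ∂μ := by
          refine lintegral_mono fun x => ?_
          refine le_trans (le_of_eq ?_) (hin x)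
          simp only [Function.comp_apply, hcons]
      -- The weight `κ 0` does not depend on the first sample `x`, so the integral over `x` falls on
      -- `φ p` alone and yields the remaining factor `C`.
      _ = ∑ p, κ 0 Fin.elim0 p * (∫⁻ x, φ p x ∂μ) * C ^ T := by
          rw [lintegral_finsetSum _ fun p _ => ((hφ p).const_mul _).mul_const _]
          refine Finset.sum_congr rfl fun p _ => ?_
          rw [lintegral_mul_const _ ((hφ p).const_mul _), lintegral_const_mul _ (hφ p)]
      _ ≤ ∑ p, κ 0 Fin.elim0 p * C * C ^ T := by
          gcongr with p
          exact hC p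
      _ = (∑ p, κ 0 Fin.elim0 p) * (C * C ^ T) := by
          rw [Finset.sum_mul]
          exact Finset.sum_congr rfl fun p _ => mul_assoc _ _ _
      _ ≤ 1 * (C * C ^ T) := by gcongr; exact hκ _ _
      _ = C ^ (T + 1) := by rw [one_mul, pow_succ']


variable {M N : ℕ} {Θ : Type*} [MeasurableSpace Θ]

/-! ### Joint play of all players -/

/-- The probability that the players draw the profile `p` in round `t`, given the profiles and
tensors of the earlier rounds. -/
noncomputable def Game.jointPlay (G : Game M N Θ) (𝓑 : BanditAlgorithm N) (T t : ℕ)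
    (h : Fin t → (Fin M → Fin N) × Θ) (p : Fin M → Fin N) : ℝ :=
  ∏ i, (𝓑.play T t (fun s => ((h s).1 i, G.u (h s).1 (h s).2 i)) : Fin N → ℝ) (p i)

/-- The probability of the sequence of profiles `a`, given the tensors `θ`. -/
noncomputable def Game.jointWeight (G : Game M N Θ) (𝓑 : BanditAlgorithm N) {T : ℕ}
    (a : Fin T → Fin M → Fin N) (θ : Fin T → Θ) : ℝ :=
  ∏ i : Fin M, 𝓑.seqProb (fun t => a t i) (fun t => G.u (a t) (θ t) i)

lemma BanditAlgorithm.play_nonneg (𝓑 : BanditAlgorithm N) (T t : ℕ) (h : Fin t → Fin N × ℝ)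
    (j : Fin N) : 0 ≤ (𝓑.play T t h : Fin N → ℝ) j :=
  (𝓑.play T t h).2.1 j

lemma BanditAlgorithm.sum_play (𝓑 : BanditAlgorithm N) (T t : ℕ) (h : Fin t → Fin N × ℝ) :
    ∑ j, (𝓑.play T t h : Fin N → ℝ) j = 1 :=
  (𝓑.play T t h).2.2

lemma Game.jointPlay_nonneg (G : Game M N Θ) (𝓑 : BanditAlgorithm N) (T t : ℕ)
    (h : Fin t → (Fin M → Fin N) × Θ) (p : Fin M → Fin N) : 0 ≤ G.jointPlay 𝓑 T t h p :=
  Finset.prod_nonneg fun _ _ => 𝓑.play_nonneg _ _ _ _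

lemma Game.sum_jointPlay (G : Game M N Θ) (𝓑 : BanditAlgorithm N) (T t : ℕ)
    (h : Fin t → (Fin M → Fin N) × Θ) : ∑ p, G.jointPlay 𝓑 T t h p = 1 := by
  unfold Game.jointPlay
  rw [← Fintype.piFinset_univ, ← Finset.prod_univ_sum]
  exact Finset.prod_eq_one fun i _ => 𝓑.sum_play _ _ _

/-- Interchanging players and rounds turns the product of individual path probabilities into a path
of the single kernel `jointPlay`. -/
lemma Game.jointWeight_eq_prod (G : Game M N Θ) (𝓑 : BanditAlgorithm N) {T : ℕ}
    (a : Fin T → Fin M → Fin N) (θ : Fin T → Θ) :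
    G.jointWeight 𝓑 a θ
      = ∏ t : Fin T, G.jointPlay 𝓑 T t (before (fun s => (a s, θ s)) t) (a t) :=
  Finset.prod_comm

lemma Game.jointWeight_nonneg (G : Game M N Θ) (𝓑 : BanditAlgorithm N) {T : ℕ}
    (a : Fin T → Fin M → Fin N) (θ : Fin T → Θ) : 0 ≤ G.jointWeight 𝓑 a θ :=
  Finset.prod_nonneg fun _ _ => Finset.prod_nonneg fun _ _ => 𝓑.play_nonneg _ _ _ _

/-- Kernels are indexed by all of `ℕ`, whereas tensors are given only for the rounds before `T`. The
values of the extension from `T` on are never read. -/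
lemma exists_nat_extension {α : Type*} [Nonempty α] {T : ℕ} (x : Fin T → α) :
    ∃ y : ℕ → α, x = fun t : Fin T => y t := by
  classical
  exact ⟨fun n => if h : n < T then x ⟨n, h⟩ else Classical.arbitrary α, by simp⟩

lemma Game.nonempty (G : Game M N Θ) : Nonempty Θ :=
  have := G.isProbabilityMeasure_r
  nonempty_of_isProbabilityMeasure G.r

lemma Game.sum_jointWeight (G : Game M N Θ) (𝓑 : BanditAlgorithm N) {T : ℕ} (θ : Fin T → Θ) :
    ∑ a, G.jointWeight 𝓑 a θ = 1 := by
  have := G.nonempty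
  obtain ⟨θ, rfl⟩ := exists_nat_extension θ
  simp only [G.jointWeight_eq_prod]
  exact sum_prod_kernel_eq_one T (fun t h => G.jointPlay 𝓑 T t fun s => (h s, θ s))
    fun t h => G.sum_jointPlay _ _ _ _

lemma Game.jointWeight_le_one (G : Game M N Θ) (𝓑 : BanditAlgorithm N) {T : ℕ}
    (a : Fin T → Fin M → Fin N) (θ : Fin T → Θ) : G.jointWeight 𝓑 a θ ≤ 1 := by
  rw [← G.sum_jointWeight 𝓑 θ]
  exact Finset.single_le_sum (f := fun a => G.jointWeight 𝓑 a θ)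
    (fun a _ => G.jointWeight_nonneg 𝓑 a θ) (Finset.mem_univ a)

lemma Game.measurable_jointPlay (G : Game M N Θ) (𝓑 : BanditAlgorithm N) (T t : ℕ)
    (a : Fin t → Fin M → Fin N) (p : Fin M → Fin N) :
    Measurable fun θ : Fin t → Θ => G.jointPlay 𝓑 T t (fun s => (a s, θ s)) p := by
  refine Finset.measurable_prod _ fun i _ => ?_
  refine (𝓑.measurable_play T t (p i)).comp (measurable_pi_lambda _ fun s => ?_)
  exact measurable_const.prodMk ((G.measurable_u (a s) i).comp (measurable_pi_apply s))

lemma Game.measurable_jointWeight (G : Game M N Θ) (𝓑 : BanditAlgorithm N) {T : ℕ}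
    (a : Fin T → Fin M → Fin N) : Measurable fun θ => G.jointWeight 𝓑 a θ := by
  simp only [G.jointWeight_eq_prod]
  refine Finset.measurable_prod _ fun t _ => ?_
  exact (G.measurable_jointPlay 𝓑 T t (before a t) (a t)).comp
    (f := fun θ : Fin T → Θ => before θ t)
    (measurable_pi_lambda _ fun s => measurable_pi_apply _)

lemma Game.integrable_jointWeight (G : Game M N Θ) (𝓑 : BanditAlgorithm N) {T : ℕ}
    (a : Fin T → Fin M → Fin N) :
    Integrable (fun θ => G.jointWeight 𝓑 a θ) (Measure.pi fun _ => G.r) := by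
  have := G.isProbabilityMeasure_r
  refine Integrable.of_bound (G.measurable_jointWeight 𝓑 a).aestronglyMeasurable 1
    (Filter.Eventually.of_forall fun θ => ?_)
  rw [Real.norm_of_nonneg (G.jointWeight_nonneg 𝓑 a θ)]
  exact G.jointWeight_le_one 𝓑 a θ

lemma Game.playProb_nonneg (G : Game M N Θ) (𝓑 : BanditAlgorithm N) {T : ℕ}
    (a : Fin T → Fin M → Fin N) : 0 ≤ G.playProb 𝓑 a :=
  integral_nonneg fun θ => G.jointWeight_nonneg 𝓑 a θ

/-- Conditioning on the tensors: bounds valid for each fixed `θ` can be integrated. -/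
lemma Game.playExp_eq_integral (G : Game M N Θ) (𝓑 : BanditAlgorithm N) (T : ℕ)
    (F : (Fin T → Fin M → Fin N) → ℝ) :
    G.playExp 𝓑 T F = ∫ θ, ∑ a, G.jointWeight 𝓑 a θ * F a ∂(Measure.pi fun _ => G.r) := by
  rw [integral_finsetSum _ fun a _ => (G.integrable_jointWeight 𝓑 a).mul_const _]
  simp only [integral_mul_const]
  rfl

lemma Game.sum_playProb (G : Game M N Θ) (𝓑 : BanditAlgorithm N) (T : ℕ) :
    ∑ a : Fin T → Fin M → Fin N, G.playProb 𝓑 a = 1 := by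
  have := G.isProbabilityMeasure_r
  have h := G.playExp_eq_integral 𝓑 T fun _ => 1
  simpa [Game.playExp, G.sum_jointWeight] using h

/-! ### Realized swap regret -/

/-- If the bound failed at `T`, every admissible threshold would exceed `T`, and so would the
infimum. This also covers the value `⊤`. -/
lemma BanditAlgorithm.forall_expAvgSwapRegret_le (𝓑 : BanditAlgorithm N) {δ : ℝ} {T : ℕ}
    (h : 𝓑.rounds δ ≤ (T : ℕ∞)) (β : AdaptiveAdversary N) : 𝓑.expAvgSwapRegret T β ≤ δ := by
  by_contra hβ
  have : ((T + 1 : ℕ) : ℕ∞) ≤ 𝓑.rounds δ := by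
    refine le_iInf₂ fun B hB => ?_
    rw [Nat.cast_le]
    by_contra hlt
    exact hβ (hB T (by omega) β)
  have := this.trans h
  rw [Nat.cast_le] at this
  omega

/-- For fixed tensors, the others act as a randomized adaptive adversary against player `i`. -/
lemma Game.sum_jointWeight_mul_swapRegret_le (G : Game M N Θ) (𝓑 : BanditAlgorithm N) {T : ℕ}
    {δ : ℝ} (hδ : ∀ β : AdaptiveAdversary N, 𝓑.expAvgSwapRegret T β ≤ δ) (i : Fin M)
    (θ : Fin T → Θ) :
    ∑ a, G.jointWeight 𝓑 a θ * (swapRegret (fun t => a t i)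
      (fun t j => G.u (Function.update (a t) i j) (θ t) i) / T) ≤ δ := by
  have := G.nonempty
  obtain ⟨θ, rfl⟩ := exists_nat_extension θ
  -- A profile is split into the action of player `i` and the reply of the opponents.
  let e : (Fin M → Fin N) ≃ Fin N × ({j // j ≠ i} → Fin N) := Equiv.funSplitAt i (Fin N)
  have he : ∀ x y, e.symm (x, y) i = x := fun x y => by simp [e]
  have hu : ∀ x y j, Function.update (e.symm (x, y)) i j = e.symm (j, y) := fun x y j => by
    funext k
    by_cases hk : k = i
    · subst hk; simp [e]
    · simp [e, hk]
  obtain ⟨g, hg⟩ := exists_replyPath_ge T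
    (fun t h x => (𝓑.play T t (fun s => ((h s).1, G.u (e.symm (h s)) (θ s) i)) : Fin N → ℝ) x)
    (fun t h y => ∏ j : {j // j ≠ i}, (𝓑.play T t
      (fun s => (e.symm (h s) j, G.u (e.symm (h s)) (θ s) j)) : Fin N → ℝ) (y j))
    (fun z => swapRegret (fun t => (z t).1) (fun t j => G.u (e.symm (j, (z t).2)) (θ t) i) / T)
    (fun t h x => 𝓑.play_nonneg _ _ _ _)
    (fun t h y => Finset.prod_nonneg fun _ _ => 𝓑.play_nonneg _ _ _ _)
    (fun t h => by
      rw [← Fintype.piFinset_univ, ← Finset.prod_univ_sum]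
      exact Finset.prod_eq_one fun i _ => 𝓑.sum_play _ _ _)
  -- With `θ` fixed and the replies `g` deterministic, the reward vector of round `t` is a function
  -- of player `i`'s past actions, as required of an adversary.
  refine le_trans (le_of_eq ?_) (hg.trans (hδ
    { reward := fun t past j => G.u (e.symm (j, g t past)) (θ t) i
      reward_mem := fun t past j => G.u_mem _ _ _ }))
  rw [← (Equiv.arrowCongr (Equiv.refl (Fin T)) e.symm).sum_comp]
  refine Finset.sum_congr rfl fun z _ => ?_
  have hz : ∀ t, (Equiv.arrowCongr (Equiv.refl (Fin T)) e.symm) z t = e.symm ((z t).1, (z t).2) :=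
    fun t => rfl
  simp only [hz, he, hu]
  congr 1
  rw [G.jointWeight_eq_prod]
  refine Finset.prod_congr rfl fun t _ => ?_
  unfold Game.jointPlay
  rw [Fintype.prod_eq_mul_prod_subtype_ne _ i]
  congr 1
  · simp only [before, he, hz]
    rfl
  · refine Finset.prod_congr rfl fun j _ => ?_
    have : e.symm ((z t).1, (z t).2) j = (z t).2 j := by simp [e, j.2]
    simp only [before, hz, this]
    rfl

/-! ### Concentration of the realized gains around the mean gains -/

/-- The mean gain minus the realized gain of player `i` from the swap function `f`. -/
noncomputable def Game.gainDeviation (G : Game M N Θ) (i : Fin M) (f : Fin N → Fin N)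
    (p : Fin M → Fin N) (θ : Θ) : ℝ :=
  (G.mean (deviate i f p) i - G.mean p i) - (G.u (deviate i f p) θ i - G.u p θ i)

lemma Game.integrable_u (G : Game M N Θ) (p : Fin M → Fin N) (i : Fin M) :
    Integrable (fun θ => G.u p θ i) G.r := by
  have := G.isProbabilityMeasure_r
  refine Integrable.of_bound (G.measurable_u p i).aestronglyMeasurable 1
    (Filter.Eventually.of_forall fun θ => ?_)
  rw [Real.norm_of_nonneg (G.u_mem p θ i).1]
  exact (G.u_mem p θ i).2

lemma Game.mean_mem (G : Game M N Θ) (p : Fin M → Fin N) (i : Fin M) :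
    G.mean p i ∈ Set.Icc (0 : ℝ) 1 := by
  have := G.isProbabilityMeasure_r
  refine ⟨integral_nonneg fun θ => (G.u_mem p θ i).1, ?_⟩
  have := integral_mono (G.integrable_u p i) (integrable_const (1 : ℝ))
    fun θ => (G.u_mem p θ i).2
  rw [integral_const, probReal_univ, one_smul] at this
  exact this

lemma Game.measurable_gainDeviation (G : Game M N Θ) (i : Fin M) (f : Fin N → Fin N)
    (p : Fin M → Fin N) : Measurable (G.gainDeviation i f p) :=
  measurable_const.sub ((G.measurable_u _ i).sub (G.measurable_u _ i))

lemma Game.abs_gainDeviation_le (G : Game M N Θ) (i : Fin M) (f : Fin N → Fin N)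
    (p : Fin M → Fin N) (θ : Θ) : |G.gainDeviation i f p θ| ≤ 2 := by
  have h1 := G.mean_mem p i
  have h2 := G.mean_mem (deviate i f p) i
  have h3 := G.u_mem p θ i
  have h4 := G.u_mem (deviate i f p) θ i
  simp only [Set.mem_Icc] at *
  unfold Game.gainDeviation
  rw [abs_le]
  constructor <;> linarith

lemma Game.integrable_gainDeviation (G : Game M N Θ) (i : Fin M) (f : Fin N → Fin N)
    (p : Fin M → Fin N) : Integrable (G.gainDeviation i f p) G.r := by
  have := G.isProbabilityMeasure_r
  exact (integrable_const _).sub ((G.integrable_u _ i).sub (G.integrable_u _ i))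

lemma Game.integral_gainDeviation (G : Game M N Θ) (i : Fin M) (f : Fin N → Fin N)
    (p : Fin M → Fin N) : ∫ θ, G.gainDeviation i f p θ ∂G.r = 0 := by
  have := G.isProbabilityMeasure_r
  have hd : Integrable (fun θ => G.u (deviate i f p) θ i - G.u p θ i) G.r :=
    (G.integrable_u _ i).sub (G.integrable_u _ i)
  unfold Game.gainDeviation
  rw [integral_sub (integrable_const _) hd, integral_sub (G.integrable_u _ i) (G.integrable_u _ i)]
  simp [Game.mean]

/-- For `|x| ≤ 1` one has `exp x ≤ 1 + x + x ^ 2`. With `x` equal to `l` times a deviation, `x` has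
mean zero and `|x| ≤ 2 * l ≤ 1`, so the expectation is at most `1 + 4 * l ^ 2`. -/
lemma Game.lintegral_exp_gainDeviation_le (G : Game M N Θ) (i : Fin M) (f : Fin N → Fin N)
    {l : ℝ} (hl : 0 ≤ l) (hl' : 2 * l ≤ 1) (p : Fin M → Fin N) :
    ∫⁻ θ, ENNReal.ofReal (Real.exp (l * G.gainDeviation i f p θ)) ∂G.r
      ≤ ENNReal.ofReal (Real.exp (4 * l ^ 2)) := by
  have := G.isProbabilityMeasure_r
  have hbound : ∀ θ, Real.exp (l * G.gainDeviation i f p θ)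
      ≤ 1 + l * G.gainDeviation i f p θ + 4 * l ^ 2 := by
    intro θ
    have habs : |l * G.gainDeviation i f p θ| ≤ l * 2 := by
      rw [abs_mul, abs_of_nonneg hl]
      exact mul_le_mul_of_nonneg_left (G.abs_gainDeviation_le i f p θ) hl
    have h1 := (abs_le.1 (Real.abs_exp_sub_one_sub_id_le (habs.trans (by linarith)))).2
    have h2 := sq_le_sq' (abs_le.1 habs).1 (abs_le.1 habs).2
    nlinarith
  have hint₁ : Integrable (fun θ => 1 + l * G.gainDeviation i f p θ) G.r :=
    (integrable_const _).add ((G.integrable_gainDeviation i f p).const_mul l)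
  have hint : Integrable (fun θ => 1 + l * G.gainDeviation i f p θ + 4 * l ^ 2) G.r :=
    hint₁.add (integrable_const _)
  calc _ ≤ ∫⁻ θ, ENNReal.ofReal (1 + l * G.gainDeviation i f p θ + 4 * l ^ 2) ∂G.r :=
        lintegral_mono fun θ => ENNReal.ofReal_le_ofReal (hbound θ)
    _ = ENNReal.ofReal (∫ θ, (1 + l * G.gainDeviation i f p θ + 4 * l ^ 2) ∂G.r) :=
        (ofReal_integral_eq_lintegral_ofReal hint (Filter.Eventually.of_forall fun θ =>
          (Real.exp_pos _).le.trans (hbound θ))).symm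
    _ ≤ _ := by
        refine ENNReal.ofReal_le_ofReal ?_
        rw [integral_add hint₁ (integrable_const _),
          integral_add (integrable_const _) ((G.integrable_gainDeviation i f p).const_mul l),
          integral_const_mul, G.integral_gainDeviation]
        have := Real.add_one_le_exp (4 * l ^ 2)
        simp
        linarith

/-- The exponential of the sum factors over rounds, and `jointPlay` in round `t` sees only earlier
tensors, so `lintegral_sum_prod_kernel_le` applies. -/
lemma Game.lintegral_sum_jointWeight_mul_exp_le (G : Game M N Θ) (𝓑 : BanditAlgorithm N) (T : ℕ)
    (i : Fin M) (f : Fin N → Fin N) {l : ℝ} (hl : 0 ≤ l) (hl' : 2 * l ≤ 1) :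
    ∫⁻ θ : Fin T → Θ, ENNReal.ofReal (∑ a, G.jointWeight 𝓑 a θ *
        Real.exp (l * ∑ t, G.gainDeviation i f (a t) (θ t))) ∂(Measure.pi fun _ => G.r)
      ≤ ENNReal.ofReal (Real.exp (4 * l ^ 2 * T)) := by
  have := G.isProbabilityMeasure_r
  have h := lintegral_sum_prod_kernel_le G.r
    (fun p θ => ENNReal.ofReal (Real.exp (l * G.gainDeviation i f p θ)))
    (fun p => ((G.measurable_gainDeviation i f p).const_mul l).exp.ennreal_ofReal)
    (ENNReal.ofReal (Real.exp (4 * l ^ 2)))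
    (G.lintegral_exp_gainDeviation_le i f hl hl') T
    (fun t h p => ENNReal.ofReal (G.jointPlay 𝓑 T t h p))
    (fun t a p => (G.measurable_jointPlay 𝓑 T t a p).ennreal_ofReal)
    (fun t h => by
      rw [← ENNReal.ofReal_sum_of_nonneg fun p _ => G.jointPlay_nonneg 𝓑 T t h p,
        G.sum_jointPlay, ENNReal.ofReal_one])
  rw [← ENNReal.ofReal_pow (Real.exp_pos _).le, ← Real.exp_nat_mul, mul_comm (T : ℝ)] at h
  refine le_trans (le_of_eq ?_) h
  refine lintegral_congr fun θ => ?_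
  rw [ENNReal.ofReal_sum_of_nonneg fun a _ =>
    mul_nonneg (G.jointWeight_nonneg 𝓑 a θ) (Real.exp_pos _).le]
  refine Finset.sum_congr rfl fun a _ => ?_
  rw [G.jointWeight_eq_prod, Finset.mul_sum, Real.exp_sum, ← Finset.prod_mul_distrib,
    ENNReal.ofReal_prod_of_nonneg]
  swap
  · exact fun t _ => mul_nonneg (G.jointPlay_nonneg 𝓑 T t _ _) (Real.exp_pos _).le
  exact Finset.prod_congr rfl fun t _ => ENNReal.ofReal_mul (G.jointPlay_nonneg 𝓑 T t _ _)

/-- The expected exponential of the total deviation for `f`, given the tensors. -/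
noncomputable def Game.expDeviation (G : Game M N Θ) (𝓑 : BanditAlgorithm N) {T : ℕ}
    (i : Fin M) (l : ℝ) (f : Fin N → Fin N) (θ : Fin T → Θ) : ℝ :=
  ∑ a, G.jointWeight 𝓑 a θ * Real.exp (l * ∑ t, G.gainDeviation i f (a t) (θ t))

lemma Game.integrable_expDeviation (G : Game M N Θ) (𝓑 : BanditAlgorithm N) (T : ℕ)
    (i : Fin M) (f : Fin N → Fin N) {l : ℝ} (hl : 0 ≤ l) (hl' : 2 * l ≤ 1) :
    Integrable (G.expDeviation 𝓑 (T := T) i l f) (Measure.pi fun _ => G.r) ∧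
    ∫ θ : Fin T → Θ, G.expDeviation 𝓑 i l f θ ∂(Measure.pi fun _ => G.r)
      ≤ Real.exp (4 * l ^ 2 * T) := by
  have hm : Measurable (G.expDeviation 𝓑 (T := T) i l f) := by
    refine Finset.measurable_sum _ fun a _ => (G.measurable_jointWeight 𝓑 a).mul ?_
    refine (Measurable.const_mul (Finset.measurable_sum _ fun t _ => ?_) l).exp
    exact (G.measurable_gainDeviation i f (a t)).comp (measurable_pi_apply t)
  have h0 : ∀ θ : Fin T → Θ, 0 ≤ G.expDeviation 𝓑 i l f θ := fun θ =>
    Finset.sum_nonneg fun a _ => mul_nonneg (G.jointWeight_nonneg 𝓑 a θ) (Real.exp_pos _).le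
  have hle := G.lintegral_sum_jointWeight_mul_exp_le 𝓑 T i f hl hl'
  constructor
  · refine ⟨hm.aestronglyMeasurable, ?_⟩
    rw [hasFiniteIntegral_iff_ofReal (Filter.Eventually.of_forall h0)]
    exact hle.trans_lt ENNReal.ofReal_lt_top
  · rw [integral_eq_lintegral_of_nonneg_ae (Filter.Eventually.of_forall h0)
      hm.aestronglyMeasurable]
    exact ENNReal.toReal_le_of_le_ofReal (Real.exp_pos _).le hle

/-! ### The swap gain of the empirical distribution -/

lemma sum_empirical_mul {T : ℕ} (a : Fin T → Fin M → Fin N) (F : (Fin M → Fin N) → ℝ) :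
    ∑ p, empirical a p * F p = (∑ t, F (a t)) / T := by
  simp only [empirical, div_mul_eq_mul_div, ← Finset.sum_div, Finset.sum_mul, ite_mul, one_mul,
    zero_mul]
  rw [Finset.sum_comm]
  simp

/-- A bound on each path: regret controls the realized gain, and the sum of exponentials over all
`f` dominates the largest deviation. Replacing the logarithm of that sum by its tangent at `K` makes
the bound linear in the exponentials, so it can be averaged without Jensen's inequality. -/
lemma Game.swapGain_empirical_le (G : Game M N Θ) {T : ℕ} (hT : 1 ≤ T)
    (a : Fin T → Fin M → Fin N) (θ : Fin T → Θ) (i : Fin M) {l K : ℝ} (hl : 0 < l) (hK : 0 < K) :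
    G.swapGain (empirical a) i
      ≤ swapRegret (fun t => a t i) (fun t j => G.u (Function.update (a t) i j) (θ t) i) / T
        + (Real.log K - 1 + (∑ f, Real.exp (l * ∑ t, G.gainDeviation i f (a t) (θ t))) / K)
          / (l * T) := by
  have hT' : (0 : ℝ) < T := by exact_mod_cast hT
  unfold Game.swapGain
  rw [sub_le_iff_le_add]
  refine Finset.sup'_le _ _ fun f _ => ?_
  rw [sum_empirical_mul, sum_empirical_mul]
  set S := ∑ t, G.gainDeviation i f (a t) (θ t) with hS
  have h1 : ∑ t, G.u (deviate i f (a t)) (θ t) i - ∑ t, G.u (a t) (θ t) i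
      ≤ swapRegret (fun t => a t i) (fun t j => G.u (Function.update (a t) i j) (θ t) i) := by
    unfold swapRegret
    refine sub_le_sub (Finset.le_sup' (fun f : Fin N → Fin N =>
      ∑ t, G.u (Function.update (a t) i (f (a t i))) (θ t) i) (Finset.mem_univ f)) (le_of_eq ?_)
    simp
  have h2 : l * S ≤ Real.log K - 1
      + (∑ f, Real.exp (l * ∑ t, G.gainDeviation i f (a t) (θ t))) / K := by
    -- This is the tangent inequality `log y ≤ log K - 1 + y / K` at `y = exp (l * S)`.
    have h3 := Real.add_one_le_exp (l * S - Real.log K)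
    rw [Real.exp_sub, Real.exp_log hK] at h3
    have h4 : Real.exp (l * S) ≤ ∑ f, Real.exp (l * ∑ t, G.gainDeviation i f (a t) (θ t)) :=
      Finset.single_le_sum
        (f := fun f => Real.exp (l * ∑ t, G.gainDeviation i f (a t) (θ t)))
        (fun _ _ => (Real.exp_pos _).le) (Finset.mem_univ f)
    have h5 := div_le_div_of_nonneg_right h4 hK.le
    linarith
  have h6 : S / T ≤ (Real.log K - 1
      + (∑ f, Real.exp (l * ∑ t, G.gainDeviation i f (a t) (θ t))) / K) / (l * T) := by
    rw [← mul_div_mul_left S (T : ℝ) hl.ne']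
    gcongr
  have h7 := div_le_div_of_nonneg_right h1 hT'.le
  have h8 : (∑ t, G.mean (deviate i f (a t)) i) / T
      = (∑ t, G.u (deviate i f (a t)) (θ t) i - ∑ t, G.u (a t) (θ t) i) / T + S / T
        + (∑ t, G.mean (a t) i) / T := by
    rw [hS]
    simp only [Game.gainDeviation, Finset.sum_sub_distrib]
    ring
  rw [h8]
  linarith

lemma Game.swapGain_empirical_le_one (G : Game M N Θ) {T : ℕ} (hT : 1 ≤ T)
    (a : Fin T → Fin M → Fin N) (i : Fin M) : G.swapGain (empirical a) i ≤ 1 := by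
  have hT' : (0 : ℝ) < T := by exact_mod_cast hT
  unfold Game.swapGain
  rw [sub_le_iff_le_add]
  refine Finset.sup'_le _ _ fun f _ => ?_
  rw [sum_empirical_mul, sum_empirical_mul]
  have h1 : (∑ t, G.mean (deviate i f (a t)) i) / T ≤ 1 := by
    rw [div_le_one hT']
    calc _ ≤ ∑ _t : Fin T, (1 : ℝ) := Finset.sum_le_sum fun t _ => (G.mean_mem _ i).2
      _ = T := by simp
  have h2 : 0 ≤ (∑ t, G.mean (a t) i) / T :=
    div_nonneg (Finset.sum_nonneg fun t _ => (G.mean_mem _ i).1) hT'.le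
  linarith

/-! ### Expectation bounds and choice of parameters -/

lemma Game.playExp_mono (G : Game M N Θ) (𝓑 : BanditAlgorithm N) (T : ℕ)
    {F F' : (Fin T → Fin M → Fin N) → ℝ} (h : ∀ a, F a ≤ F' a) :
    G.playExp 𝓑 T F ≤ G.playExp 𝓑 T F' :=
  Finset.sum_le_sum fun a _ => mul_le_mul_of_nonneg_left (h a) (G.playProb_nonneg 𝓑 a)

lemma Game.playExp_swapGain_le_of_regret (G : Game M N Θ) (𝓑 : BanditAlgorithm N) {T : ℕ}
    (hT : 1 ≤ T) {δ : ℝ} (hδ : ∀ β : AdaptiveAdversary N, 𝓑.expAvgSwapRegret T β ≤ δ)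
    (i : Fin M) {l : ℝ} (hl : 0 < l) (hl' : 2 * l ≤ 1) :
    G.playExp 𝓑 T (fun a => G.swapGain (empirical a) i)
      ≤ δ + (N * Real.log N + 4 * l ^ 2 * T) / (l * T) := by
  have := G.isProbabilityMeasure_r
  have hT' : (0 : ℝ) < T := by exact_mod_cast hT
  -- For `N = 0` this is `0 ^ 0 = 1`.
  have hNN : (0 : ℝ) < (N : ℝ) ^ N := by
    rcases Nat.eq_zero_or_pos N with rfl | hN
    · simp
    · positivity
  -- `K` bounds the expected sum of exponentials: `N ^ N` swap functions, each contributing at most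
  -- `exp (4 * l ^ 2 * T)`. Hence the tangent term averages to at most `log K`.
  set K : ℝ := (N : ℝ) ^ N * Real.exp (4 * l ^ 2 * T) with hKdef
  have hK : 0 < K := mul_pos hNN (Real.exp_pos _)
  have hlogK : Real.log K = N * Real.log N + 4 * l ^ 2 * T := by
    rw [hKdef, Real.log_mul hNN.ne' (Real.exp_pos _).ne', Real.log_exp, Real.log_pow]
  have hE := fun f => G.integrable_expDeviation 𝓑 T i f hl.le hl'
  have hsum : Integrable (fun θ : Fin T → Θ => ∑ f, G.expDeviation 𝓑 i l f θ)
      (Measure.pi fun _ => G.r) := integrable_finsetSum _ fun f _ => (hE f).1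
  have hintle : ∫ θ : Fin T → Θ, ∑ f, G.expDeviation 𝓑 i l f θ ∂(Measure.pi fun _ => G.r) ≤ K := by
    rw [integral_finsetSum _ fun f _ => (hE f).1]
    refine (Finset.sum_le_sum fun f _ => (hE f).2).trans (le_of_eq ?_)
    simp [hKdef]
  rw [G.playExp_eq_integral]
  have hpt : ∀ θ : Fin T → Θ, ∑ a, G.jointWeight 𝓑 a θ * G.swapGain (empirical a) i
      ≤ δ + (Real.log K - 1 + (∑ f, G.expDeviation 𝓑 i l f θ) / K) / (l * T) := by
    intro θ
    refine (Finset.sum_le_sum fun a _ => mul_le_mul_of_nonneg_left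
      (G.swapGain_empirical_le hT a θ i hl hK) (G.jointWeight_nonneg 𝓑 a θ)).trans ?_
    simp only [mul_add, Finset.sum_add_distrib]
    refine add_le_add (G.sum_jointWeight_mul_swapRegret_le 𝓑 hδ i θ) (le_of_eq ?_)
    simp only [mul_div_assoc', mul_add, ← Finset.sum_div, Finset.sum_add_distrib,
      ← Finset.sum_mul, G.sum_jointWeight, one_mul, Game.expDeviation]
    rw [Finset.sum_comm]
    simp only [← Finset.mul_sum]
  have hint : Integrable (fun θ : Fin T → Θ =>
      (Real.log K - 1 + (∑ f, G.expDeviation 𝓑 i l f θ) / K) / (l * T))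
      (Measure.pi fun _ => G.r) :=
    ((integrable_const _).add (hsum.div_const K)).div_const _
  refine (integral_mono (integrable_finsetSum _ fun a _ =>
    (G.integrable_jointWeight 𝓑 a).mul_const _) ((integrable_const δ).add hint) hpt).trans ?_
  simp only [Pi.add_apply]
  rw [integral_add (integrable_const δ) hint, integral_div,
    integral_add (integrable_const _) (hsum.div_const K), integral_div]
  simp only [integral_const, probReal_univ, one_smul]
  have : (∫ θ : Fin T → Θ, ∑ f, G.expDeviation 𝓑 i l f θ ∂(Measure.pi fun _ => G.r)) / K ≤ 1 :=
    (div_le_one hK).2 hintle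
  rw [add_le_add_iff_left]
  exact div_le_div_of_nonneg_right (by linarith) (by positivity)

lemma Game.playExp_swapGain_le (G : Game M N Θ) (𝓑 : BanditAlgorithm N) {ε : ℝ} (hε : 0 < ε)
    {T : ℕ} (hT : 1 ≤ T) (hB : 𝓑.extendedRounds (ε / 4) ≤ (T : ℕ∞)) (i : Fin M) :
    G.playExp 𝓑 T (fun a => G.swapGain (empirical a) i) ≤ ε := by
  have hT' : (0 : ℝ) < T := by exact_mod_cast hT
  -- For `ε ≥ 4` the trivial bound `1` on the swap gain suffices; `ε < 4` ensures `2 * l ≤ 1` for `l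
  -- = ε / 8`.
  rcases le_or_gt 4 ε with h4 | h4
  · refine (G.playExp_mono 𝓑 T fun a => G.swapGain_empirical_le_one hT a i).trans ?_
    simp only [Game.playExp, mul_one, G.sum_playProb]
    linarith
  · have hδ := 𝓑.forall_expAvgSwapRegret_le ((le_max_left _ _).trans hB)
    have hceil := (le_max_right _ _).trans hB
    rw [Nat.cast_le] at hceil
    have hT2 := (Nat.le_ceil _).trans (Nat.cast_le (α := ℝ).2 hceil)
    rw [div_le_iff₀ (by positivity)] at hT2
    -- Only the sign of this term matters; dropping it leaves `T ≥ 32 * N * log N / ε ^ 2`.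
    have hlog : 0 ≤ Real.log (2 / (ε / 4)) :=
      Real.log_nonneg ((one_le_div (by positivity)).2 (by linarith))
    -- With `l = ε / 8`, the variance term `4 * l` is `ε / 2` and the entropy term `N * log N / (l *
    -- T)` is at most `ε / 4`; regret adds another `ε / 4`.
    refine (G.playExp_swapGain_le_of_regret 𝓑 hT hδ i (l := ε / 8) (by positivity)
      (by linarith)).trans ?_
    have : (N * Real.log N + 4 * (ε / 8) ^ 2 * T) / (ε / 8 * T) ≤ 3 * (ε / 4) := by
      rw [div_le_iff₀ (by positivity)]
      nlinarith
    linarith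

lemma Game.sum_playExp_empirical_mul (G : Game M N Θ) (𝓑 : BanditAlgorithm N) (T : ℕ)
    (F : (Fin M → Fin N) → ℝ) :
    ∑ p, G.playExp 𝓑 T (fun a => empirical a p) * F p
      = G.playExp 𝓑 T (fun a => ∑ p, empirical a p * F p) := by
  simp only [Game.playExp, Finset.sum_mul, Finset.mul_sum]
  rw [Finset.sum_comm]
  simp only [mul_assoc]

/-- The gain of a fixed `f` is linear in the distribution, so its value at the averaged distribution
is an expectation, at most that of the maximum over `f`. -/
lemma Game.isCorrelatedEquilibrium_playExp_empirical (G : Game M N Θ) (𝓑 : BanditAlgorithm N)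
    {ε : ℝ} {T : ℕ} (hT : 1 ≤ T)
    (h : ∀ i, G.playExp 𝓑 T (fun a => G.swapGain (empirical a) i) ≤ ε) :
    G.IsCorrelatedEquilibrium ε (fun p => G.playExp 𝓑 T (fun a => empirical a p)) := by
  have hT' : (T : ℝ) ≠ 0 := by positivity
  refine ⟨⟨fun p => ?_, ?_⟩, fun i f => ?_⟩
  · refine Finset.sum_nonneg fun a _ => mul_nonneg (G.playProb_nonneg 𝓑 a) ?_
    exact div_nonneg (Finset.sum_nonneg fun t _ => by split_ifs <;> norm_num) (Nat.cast_nonneg T)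
  · have h1 := G.sum_playExp_empirical_mul 𝓑 T fun _ => 1
    simp only [sum_empirical_mul] at h1
    simpa [hT', Game.playExp, G.sum_playProb] using h1
  · have h1 := (G.playExp_mono 𝓑 T (F := fun a =>
      ∑ p, empirical a p * G.mean (deviate i f p) i - ∑ p, empirical a p * G.mean p i)
      fun a => sub_le_sub_right (Finset.le_sup' (fun f : Fin N → Fin N =>
        ∑ p, empirical a p * G.mean (deviate i f p) i) (Finset.mem_univ f)) _).trans (h i)
    rw [G.sum_playExp_empirical_mul 𝓑 T (fun p => G.mean p i),
      G.sum_playExp_empirical_mul 𝓑 T (fun p => G.mean (deviate i f p) i)]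
    simp only [Game.playExp, mul_sub, Finset.sum_sub_distrib] at h1 ⊢
    linarith

end StochasticRewards

theorem theorem3 {M N : ℕ} {Θ : Type*} [MeasurableSpace Θ]
    (G : StochasticRewards.Game M N Θ) (𝓑 : StochasticRewards.BanditAlgorithm N)
    (ε : ℝ) (hε : 0 < ε) (T : ℕ) (hT : 1 ≤ T) (hB : 𝓑.extendedRounds (ε / 4) ≤ (T : ℕ∞)) :
    (∀ i : Fin M,
      G.playExp 𝓑 T (fun a => G.swapGain (StochasticRewards.empirical a) i) ≤ ε) ∧
    G.IsCorrelatedEquilibrium ε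
      (fun p => G.playExp 𝓑 T (fun a => StochasticRewards.empirical a p)) := by
  have h := G.playExp_swapGain_le 𝓑 hε hT hB
  exact ⟨h, G.isCorrelatedEquilibrium_playExp_empirical 𝓑 hT h⟩
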